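/- Let $n\ge 0$ be an integer and let $\mathcal B_n$ be the class of operators $B$ that carry each complex polynomial $P$ of degree at most $n$ to $$B[P](z)=\lambda_0P(z)+\lambda_1\left(\frac{nz}{2}\right)\frac{P'(z)}{1!}+\lambda_2\left(\frac{nz}{2}\right)^2\frac{P''(z)}{2!},$$ where $\lambda_0,\lambda_1,\lambda_2\in\mathbb C$ are such that all the zeros of $U(z)=\lambda_0+n\lambda_1z+\frac{n(n-1)}{2}\lambda_2z^2$ lie in the half plane $|z|\le|z-n/2|$. Let $B\in\mathcal B_n$, let $R>r\ge k>0$, and put $\sigma(z)=Rz$, $\rho(z)=rz$. Let $F$ be a complex polynomial of degree exactly $n$ all of whose zeros lie in $|z|\le k$. If $P$ is a complex polynomial of degree at most $n$ such that $|P(z)|\le|F(z)|$ for $|z|=k$, then for every $\beta\in\mathbb C$ with $|\beta|\le1$ and every $z\in\mathbb C$ with $|z|\ge1$, $$\left|B[P\circ\sigma](z)+\beta\left(\frac{R+k}{k+r}\right)^nB[P\circ\rho](z)\right|\le\left|B[F\circ\sigma](z)+\beta\left(\frac{R+k}{k+r}\right)^nB[F\circ\rho](z)\right|.$$ The result is sharp: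 for every $\gamma\in\mathbb R$ the polynomial $P(z)=e^{i\gamma}F(z)$ satisfies the hypotheses, and equality holds for it for all such $\beta$ and $z$. -/

import Mathlib

open Polynomial

namespace BnOperator

/-- The characteristic polynomial `U(z) = l₀ + n l₁ z + (n(n-1)/2) l₂ z²`. -/
noncomputable def charU (n : ℕ) (l0 l1 l2 z : ℂ) : ℂ :=
  l0 + (n : ℂ) * l1 * z + ((n : ℂ) * ((n : ℂ) - 1) / 2) * l2 * z ^ 2

/-- `B` belongs to Rahman's class `𝓑ₙ`: there are `l₀, l₁, l₂ ∈ ℂ` such that all zeros of `U` lie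
in the half plane `|z| ≤ |z - n/2|` and, for all `P` of degree at most `n`,
`B[P](z) = l₀ P(z) + l₁ (nz/2) P'(z)/1! + l₂ (nz/2)² P''(z)/2!`.
Only the values of `B` on polynomials of degree at most `n` are constrained. -/
def MemClass (n : ℕ) (B : ℂ[X] → ℂ[X]) : Prop :=
  ∃ l0 l1 l2 : ℂ,
    (∀ z : ℂ, charU n l0 l1 l2 z = 0 → ‖z‖ ≤ ‖z - (n : ℂ) / 2‖) ∧
    ∀ P : ℂ[X], P.natDegree ≤ n → ∀ z : ℂ,
      (B P).eval z =
        l0 * P.eval z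
          + l1 * ((n : ℂ) * z / 2) * (P.derivative.eval z / (Nat.factorial 1 : ℂ))
          + l2 * ((n : ℂ) * z / 2) ^ 2 *
              (P.derivative.derivative.eval z / (Nat.factorial 2 : ℂ))

/-- The polynomial `z ↦ P(s z)`, i.e. the composite of `P` with the dilation `z ↦ s z`. -/
noncomputable def dilate (P : ℂ[X]) (s : ℝ) : ℂ[X] := P.comp (C (s : ℂ) * X)

/-- `B[P∘σ](z) + β ((R+k)/(k+r))ⁿ B[P∘ρ](z)` with `σ(z) = R z` and `ρ(z) = r z`. -/
noncomputable def combo (n : ℕ) (B : ℂ[X] → ℂ[X]) (k R r : ℝ) (β : ℂ) (P : ℂ[X]) (z : ℂ) : ℂ :=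
  (B (dilate P R)).eval z
    + β * ((((R + k) / (k + r)) ^ n : ℝ) : ℂ) * (B (dilate P r)).eval z

/-- `P` is a polynomial of degree at most `n` with `|P(z)| ≤ |F(z)|` for `|z| = k`. -/
def Admissible (n : ℕ) (k : ℝ) (F P : ℂ[X]) : Prop :=
  P.natDegree ≤ n ∧ ∀ z : ℂ, ‖z‖ = k → ‖P.eval z‖ ≤ ‖F.eval z‖

end BnOperator

namespace BnOperator

/-! Write `T` for `dilateCombo`. Everything reduces to locating zeros. If `G` has degree `n ≥ 1` and
all its zeros in `|z| ≤ k`, a factorwise growth estimate puts all zeros of `T G` in `|z| ≤ 1`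
(`dilateCombo_zeros`), and then `B[T G]` has no zero in `|z| > 1` (`operatorValue_ne_zero`, by a
quadratic Walsh coincidence argument). By the maximum principle outside `|z| = k`, `P + aF` has the
same degree and zero location as `F` whenever `|a| > 1` (`add_C_mul_zeros_of_circle`). If the
inequality failed at some `|z| > 1`, the choice `a = -B[T P](z) / B[T F](z)` would have `|a| > 1`
and make `B[T(P + aF)]` vanish at `z`, a contradiction. Continuity covers `|z| = 1`. -/

/-! ### Quadratic coincidence in a half plane. -/

/-- Since `|pq| = |p q̄| ≥ Re p Re q + Im p Im q`, the imaginary parts cancel against those of `Re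
(pq)`. The sublinear functional `x ↦ |x| + Re x` drives the coincidence argument. -/
lemma norm_add_re_mul_ge {p q : ℂ} {m : ℝ} (hm : 0 < m) (hp : m ≤ p.re) (hq : m ≤ q.re) :
    2 * m ^ 2 ≤ ‖p * q‖ + (p * q).re := by
  have h1 : m ^ 2 ≤ p.re * q.re := by nlinarith
  have h2 : p.re * q.re + p.im * q.im ≤ ‖p * q‖ := by
    have := Complex.re_le_norm (p * (starRingEnd ℂ) q)
    rw [norm_mul, RCLike.norm_conj, ← norm_mul] at this
    simpa using this
  rw [Complex.mul_re]
  linarith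

lemma norm_sq_add_re_sq (d : ℂ) : ‖d ^ 2‖ + (d ^ 2).re = 2 * d.re ^ 2 := by
  rw [norm_pow, Complex.sq_norm, Complex.normSq_apply, pow_two d, Complex.mul_re]
  ring

lemma norm_sum_sq_add_re_le {ι : Type*} (s : Finset ι) (d : ι → ℂ) :
    ‖∑ i ∈ s, d i ^ 2‖ + (∑ i ∈ s, d i ^ 2).re ≤ 2 * ∑ i ∈ s, (d i).re ^ 2 := by
  calc ‖∑ i ∈ s, d i ^ 2‖ + (∑ i ∈ s, d i ^ 2).re
      ≤ ∑ i ∈ s, ‖d i ^ 2‖ + ∑ i ∈ s, (d i ^ 2).re := by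
        rw [Complex.re_sum]; gcongr; exact norm_sum_le _ _
    _ = 2 * ∑ i ∈ s, (d i).re ^ 2 := by
        rw [← Finset.sum_add_distrib, Finset.mul_sum]
        exact Finset.sum_congr rfl fun i _ => norm_sq_add_re_sq _

lemma sum_sq_lt_sq_sum {n : ℕ} (hn : 2 ≤ n) (g : Fin n → ℝ) (hg : ∀ i, 0 < g i) :
    ∑ i, g i ^ 2 < (∑ i, g i) ^ 2 := by
  have : Nontrivial (Fin n) := Fin.nontrivial_iff_two_le.mpr hn
  rw [pow_two (∑ i, g i), Finset.sum_mul]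
  refine Finset.sum_lt_sum_of_nonempty ⟨⟨0, by omega⟩, Finset.mem_univ _⟩ fun i _ => ?_
  obtain ⟨j, hj⟩ := exists_ne i
  rw [pow_two]
  exact mul_lt_mul_of_pos_left
    (Finset.single_lt_sum hj (Finset.mem_univ _) (Finset.mem_univ _) (hg j)
      fun l _ _ => (hg l).le) (hg i)

/-- The quadratic case of the Walsh coincidence theorem in the half plane `Re > 1/2`. -/
lemma polarization_ne_zero {n : ℕ} (hn : 1 ≤ n) {a0 a b : ℂ}
    (hV : ∀ x : ℂ, a0 + a * n * x + b * (n * (n - 1) / 2) * x ^ 2 = 0 → x.re ≤ 1 / 2)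
    (w : Fin n → ℂ) (hw : ∀ i, 1 / 2 < (w i).re) :
    a0 + a * ∑ i, w i + b * (((∑ i, w i) ^ 2 - ∑ i, w i ^ 2) / 2) ≠ 0 := by
  intro h0
  have hn0 : (n : ℂ) ≠ 0 := by exact_mod_cast (by omega : n ≠ 0)
  have hnR : (0 : ℝ) < n := by exact_mod_cast hn
  -- `A` is the mean of the `w i`, so it lies in the same half plane.
  obtain ⟨A, hA⟩ : ∃ A : ℂ, ∑ i, w i = n * A := ⟨(∑ i, w i) / n, by field_simp⟩
  have hAre : ∑ i, (w i).re = n * A.re := by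
    have := congrArg Complex.re hA
    simpa using this
  have hm : 0 < A.re - 1 / 2 := by
    have : ∑ i : Fin n, (1 / 2 : ℝ) < ∑ i, (w i).re :=
      Finset.sum_lt_sum_of_nonempty ⟨⟨0, by omega⟩, Finset.mem_univ _⟩ fun i _ => hw i
    rw [hAre, Finset.sum_const, Finset.card_univ, Fintype.card_fin, nsmul_eq_mul] at this
    have := lt_of_mul_lt_mul_left this hnR.le
    linarith
  rcases eq_or_lt_of_le hn with h1 | h2
  · subst h1
    simp only [Fin.sum_univ_one] at h0 hA
    have := hV A (by simp at hA ⊢; rw [← hA]; linear_combination h0)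
    linarith
  by_cases hb : b = 0
  · subst hb
    have := hV A (by rw [hA] at h0; linear_combination h0)
    linarith
  have hn1 : (n : ℂ) - 1 ≠ 0 := by
    intro h; have : (n : ℂ) = (1 : ℕ) := by push_cast; linear_combination h
    have := Nat.cast_injective this; omega
  set c : ℂ := b * (n * (n - 1) / 2) with hc
  have hc0 : c ≠ 0 := by
    rw [hc]; exact mul_ne_zero hb (div_ne_zero (mul_ne_zero hn0 hn1) two_ne_zero)
  -- `α` and `α'` are the two roots of the diagonal polynomial in `hV`.
  obtain ⟨α, hα⟩ := exists_quadratic_eq_zero (a := c) (b := a * n) (c := a0) hc0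
    (IsAlgClosed.exists_eq_mul_self _)
  obtain ⟨α', hα'⟩ : ∃ α', a * n = - c * (α + α') := ⟨-(a * n) / c - α, by field_simp; ring⟩
  have ha0 : a0 = c * (α * α') := by linear_combination hα - α * hα'
  have hre : α.re ≤ 1 / 2 := hV α (by linear_combination hα)
  have hre' : α'.re ≤ 1 / 2 := hV α' (by linear_combination ha0 + α' * hα')
  have hS : ∑ i, (w i - A) ^ 2 = ∑ i, w i ^ 2 - n * A ^ 2 := by
    simp only [sub_sq, Finset.sum_add_distrib, Finset.sum_sub_distrib, Finset.sum_const,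
      Finset.card_univ, Fintype.card_fin, nsmul_eq_mul, ← Finset.sum_mul, ← Finset.mul_sum, hA]
    ring
  -- The polarized form differs from its diagonal value at `A` by `-b/2` times this sum. Applying
  -- `|x| + Re x`, with `m = Re A - 1/2`, the right side gives at least `2n(n-1)m²`. The left gives
  -- strictly less: `e3` bounds the sum of squares by `(nm)²`, and `e4` subtracts `nm²`.
  have key : ∑ i, (w i - A) ^ 2 = (n * (n - 1)) * ((A - α) * (A - α')) := by
    rw [hS]
    rw [hA] at h0
    refine mul_left_cancel₀ hb ?_
    rw [hc] at hα' ha0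
    linear_combination (-2) * h0 + 2 * ha0 + 2 * A * hα'
  have e1 := norm_sum_sq_add_re_le Finset.univ fun i => w i - A
  have e2 := norm_add_re_mul_ge (p := A - α) (q := A - α') hm
    (by simp; linarith) (by simp; linarith)
  have e3 := sum_sq_lt_sq_sum h2 (fun i => (w i).re - 1 / 2) fun i => by linarith [hw i]
  have hN : (0 : ℝ) < n * (n - 1) := by
    have : (2 : ℝ) ≤ n := by exact_mod_cast h2
    nlinarith
  have hcast : ((n : ℂ) * (n - 1)) = ((n * (n - 1) : ℝ) : ℂ) := by push_cast; ring
  have e4 : ∑ i, (w i - A).re ^ 2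
      = ∑ i, ((w i).re - 1 / 2) ^ 2 - n * (A.re - 1 / 2) ^ 2 := by
    simp only [Complex.sub_re, sub_sq, Finset.sum_add_distrib, Finset.sum_sub_distrib,
      Finset.sum_const, Finset.card_univ, Fintype.card_fin, nsmul_eq_mul, ← Finset.sum_mul,
      ← Finset.mul_sum, hAre]
    ring
  have e5 : ∑ i, ((w i).re - 1 / 2) = n * (A.re - 1 / 2) := by
    rw [Finset.sum_sub_distrib, hAre]; simp; ring
  rw [key, hcast, norm_mul, Complex.norm_real, Real.norm_of_nonneg hN.le, Complex.re_ofReal_mul,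
    ← mul_add, e4] at e1
  rw [e5] at e3
  have := mul_le_mul_of_nonneg_left e2 hN.le
  nlinarith

/-! ### Nonvanishing of the operator outside the unit disc. -/

lemma eval_derivative_prod_X_sub_C {ι : Type*} (s : Finset ι) (ζ : ι → ℂ) (z : ℂ)
    (hz : ∀ i ∈ s, z ≠ ζ i) :
    (derivative (∏ i ∈ s, (X - C (ζ i)))).eval z
      = (∏ i ∈ s, (X - C (ζ i))).eval z * ∑ i ∈ s, (z - ζ i)⁻¹ ∧
    (derivative (derivative (∏ i ∈ s, (X - C (ζ i))))).eval z
      = (∏ i ∈ s, (X - C (ζ i))).eval z *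
        ((∑ i ∈ s, (z - ζ i)⁻¹) ^ 2 - ∑ i ∈ s, (z - ζ i)⁻¹ ^ 2) := by
  classical
  induction s using Finset.induction_on with
  | empty => simp
  | insert j s hj ih =>
    obtain ⟨h1, h2⟩ := ih fun i hi => hz i (Finset.mem_insert_of_mem hi)
    have hne : z - ζ j ≠ 0 := sub_ne_zero.mpr (hz j (Finset.mem_insert_self _ _))
    simp only [Finset.prod_insert hj, Finset.sum_insert hj, derivative_mul, derivative_add,
      derivative_sub, derivative_X, derivative_C, sub_zero, one_mul, eval_add, eval_mul, eval_sub,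
      eval_X, eval_C, h1, h2]
    constructor
    · field_simp
    · field_simp
      ring

lemma exists_eq_prod_X_sub_C {n : ℕ} {Q : ℂ[X]} (hQ : Q.natDegree = n) (hQ0 : Q ≠ 0) :
    ∃ ζ : Fin n → ℂ, Q = C Q.leadingCoeff * ∏ i, (X - C (ζ i)) ∧ ∀ i, Q.eval (ζ i) = 0 := by
  have hcard : Q.roots.toList.length = n := by
    rw [Multiset.length_toList, ← hQ, (IsAlgClosed.splits Q).natDegree_eq_card_roots]
  subst hcard
  refine ⟨fun i => Q.roots.toList[i], ?_, fun i => ?_⟩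
  · conv_lhs => rw [(IsAlgClosed.splits Q).eq_prod_roots]
    congr 1
    refine Eq.trans ?_ (Fin.prod_univ_fun_getElem Q.roots.toList fun a => X - C a).symm
    rw [← Multiset.prod_coe, ← Multiset.map_coe, Multiset.coe_toList]
  · have : Q.roots.toList[i] ∈ Q.roots := Multiset.mem_toList.mp (List.getElem_mem _)
    exact (mem_roots hQ0).mp this

/-- The value at `z` of the operator with parameters `l0`, `l1`, `l2` applied to `P`. -/
noncomputable def operatorValue (n : ℕ) (l0 l1 l2 : ℂ) (P : ℂ[X]) (z : ℂ) : ℂ :=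
  l0 * P.eval z + l1 * ((n : ℂ) * z / 2) * (P.derivative.eval z / (Nat.factorial 1 : ℂ))
    + l2 * ((n : ℂ) * z / 2) ^ 2 * (P.derivative.derivative.eval z / (Nat.factorial 2 : ℂ))

lemma re_le_half_of_norm_le {x : ℂ} (h : ‖x‖ ≤ ‖x - 1‖) : x.re ≤ 1 / 2 := by
  have := pow_le_pow_left₀ (norm_nonneg _) h 2
  rw [Complex.sq_norm, Complex.sq_norm, Complex.normSq_apply, Complex.normSq_apply] at this
  simp at this
  linarith

lemma half_lt_re_mul_inv_sub {z ζ : ℂ} (h : ‖ζ‖ < ‖z‖) : 1 / 2 < (z * (z - ζ)⁻¹).re := by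
  have hne : z - ζ ≠ 0 := sub_ne_zero.mpr fun e => by simp [e] at h
  have hpos : 0 < Complex.normSq (z - ζ) := Complex.normSq_pos.mpr hne
  have h2 := pow_lt_pow_left₀ h (norm_nonneg _) two_ne_zero
  rw [Complex.sq_norm, Complex.sq_norm, Complex.normSq_apply, Complex.normSq_apply] at h2
  rw [← div_eq_mul_inv, Complex.div_re, ← add_div, div_lt_div_iff₀ two_pos hpos,
    Complex.normSq_apply]
  simp
  linarith

/-- With `ζ i` the zeros of `H`, dividing by `H(z)` turns the operator into a polarized quadratic in
`w i = z / (z - ζ i)`, and `|ζ i| < |z|` says exactly `Re (w i) > 1/2`. -/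
lemma operatorValue_ne_zero {n : ℕ} (hn : 1 ≤ n) {l0 l1 l2 : ℂ}
    (hU : ∀ z : ℂ, charU n l0 l1 l2 z = 0 → ‖z‖ ≤ ‖z - (n : ℂ) / 2‖)
    {H : ℂ[X]} (hH : H.natDegree = n) (hH0 : H ≠ 0) (hz : ∀ z, H.eval z = 0 → ‖z‖ ≤ 1)
    {z : ℂ} (h1 : 1 < ‖z‖) : operatorValue n l0 l1 l2 H z ≠ 0 := by
  have hnR : (0 : ℝ) < n := by exact_mod_cast hn
  obtain ⟨ζ, hprod, hζ⟩ := exists_eq_prod_X_sub_C hH hH0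
  have hζz : ∀ i, ‖ζ i‖ < ‖z‖ := fun i => (hz _ (hζ i)).trans_lt h1
  have hHz : H.eval z ≠ 0 := fun h => absurd (hz z h) (not_le.mpr h1)
  obtain ⟨d1, d2⟩ := eval_derivative_prod_X_sub_C Finset.univ ζ z fun i _ e => by
    have := hζz i
    simp [e] at this
  have D1 : H.derivative.eval z = H.eval z * ∑ i, (z - ζ i)⁻¹ := by
    rw [hprod, derivative_C_mul, eval_C_mul, eval_C_mul, d1]; ring
  have D2 : H.derivative.derivative.eval z
      = H.eval z * ((∑ i, (z - ζ i)⁻¹) ^ 2 - ∑ i, (z - ζ i)⁻¹ ^ 2) := by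
    rw [hprod, derivative_C_mul, derivative_C_mul, eval_C_mul, eval_C_mul, d2]; ring
  have main := polarization_ne_zero hn (a0 := l0) (a := l1 * (n / 2)) (b := l2 * (n / 2) ^ 2)
    (fun x hx => by
      -- Rescaling by `n/2` turns the half plane `|z| ≤ |z - n/2|` into `Re x ≤ 1/2`.
      have h := hU (n / 2 * x) (by unfold charU; linear_combination hx)
      have e : (n : ℂ) / 2 * x - n / 2 = n / 2 * (x - 1) := by ring
      rw [e, norm_mul, norm_mul] at h
      refine re_le_half_of_norm_le (le_of_mul_le_mul_left h ?_)
      simpa using Nat.pos_of_ne_zero (Nat.one_le_iff_ne_zero.mp hn))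
    (fun i => z * (z - ζ i)⁻¹) (fun i => half_lt_re_mul_inv_sub (hζz i))
  have : operatorValue n l0 l1 l2 H z = H.eval z * (l0 + l1 * (n / 2) * ∑ i, z * (z - ζ i)⁻¹
      + l2 * (n / 2) ^ 2 *
        (((∑ i, z * (z - ζ i)⁻¹) ^ 2 - ∑ i, (z * (z - ζ i)⁻¹) ^ 2) / 2)) := by
    simp only [operatorValue, D1, D2, mul_pow, ← Finset.mul_sum]
    simp [Nat.factorial]
    ring
  rw [this]
  exact mul_ne_zero hHz main

/-! ### Growth between two radii. -/

/-- After squaring, right minus left is affine in `c = Re (u ζ̄)` with slope `2(R - r)(Rr - k²) ≥ 0`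
(`e1`). The worst case is `c = -|ζ|`, where the claim is `(R - r)(k - |ζ|) ≥ 0` (`e2`). -/
lemma add_mul_norm_sub_le {k r R : ℝ} (hk : 0 < k) (hkr : k ≤ r) (hrR : r ≤ R) {u ζ : ℂ}
    (hu : ‖u‖ = 1) (hζ : ‖ζ‖ ≤ k) :
    (R + k) * ‖(r : ℂ) * u - ζ‖ ≤ (r + k) * ‖(R : ℂ) * u - ζ‖ := by
  have expand : ∀ s : ℝ, ‖(s : ℂ) * u - ζ‖ ^ 2
      = s ^ 2 + ‖ζ‖ ^ 2 - 2 * s * (u * starRingEnd ℂ ζ).re := fun s => by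
    rw [Complex.sq_norm, Complex.normSq_sub, Complex.normSq_mul, ← Complex.sq_norm u, hu,
      Complex.normSq_ofReal, ← Complex.sq_norm, mul_assoc (s : ℂ), Complex.re_ofReal_mul]
    ring
  have hc : -‖ζ‖ ≤ (u * starRingEnd ℂ ζ).re := by
    have := Complex.abs_re_le_norm (u * starRingEnd ℂ ζ)
    rw [norm_mul, RCLike.norm_conj, hu, one_mul] at this
    exact (abs_le.mp this).1
  have hρ := norm_nonneg ζ
  have hr : 0 < r := hk.trans_le hkr
  have hRk : 0 < R + k := by linarith
  have hrk : 0 < r + k := by linarith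
  rw [← pow_le_pow_iff_left₀ (by positivity) (by positivity) two_ne_zero, mul_pow, mul_pow,
    expand, expand]
  have e1 : 0 ≤ 2 * (R - r) * (R * r - k ^ 2) := by
    have : k ^ 2 ≤ R * r := by nlinarith
    exact mul_nonneg (by linarith) (by linarith)
  have e2 : (R + k) * (r + ‖ζ‖) ≤ (r + k) * (R + ‖ζ‖) := by
    linarith [mul_nonneg (sub_nonneg.mpr hrR) (sub_nonneg.mpr hζ)]
  have e3 := pow_le_pow_left₀ (by positivity) e2 2
  have e4 := mul_nonneg e1 (neg_le_iff_add_nonneg'.mp hc)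
  linarith

lemma add_pow_mul_norm_eval_le {n : ℕ} {k r R : ℝ} (hk : 0 < k) (hkr : k ≤ r) (hrR : r ≤ R)
    {Q : ℂ[X]} (hQ : Q.natDegree = n) (hQ0 : Q ≠ 0) (hz : ∀ z, Q.eval z = 0 → ‖z‖ ≤ k)
    {u : ℂ} (hu : ‖u‖ = 1) :
    (R + k) ^ n * ‖Q.eval (r * u)‖ ≤ (r + k) ^ n * ‖Q.eval (R * u)‖ := by
  obtain ⟨ζ, hprod, hζ⟩ := exists_eq_prod_X_sub_C hQ hQ0
  have hcard : ∀ x : ℝ, x ^ n = ∏ _i : Fin n, x := by simp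
  rw [hprod]
  simp only [eval_C_mul, eval_prod, eval_sub, eval_X, eval_C, norm_mul, norm_prod]
  rw [mul_left_comm, mul_left_comm ((r + k) ^ n), hcard, hcard, ← Finset.prod_mul_distrib,
    ← Finset.prod_mul_distrib]
  refine mul_le_mul_of_nonneg_left (Finset.prod_le_prod (fun i _ => ?_) fun i _ => ?_)
    (norm_nonneg _)
  · have : 0 < R + k := by linarith
    positivity
  · exact add_mul_norm_sub_le hk hkr hrR hu (hz _ (hζ i))

/-! ### Domination outside the circle `|z| = k`. -/

lemma eval_reflect_inv {n : ℕ} {P : ℂ[X]} (hP : P.natDegree ≤ n) {z : ℂ} (hz : z ≠ 0) :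
    (reflect n P).eval z⁻¹ * z ^ n = P.eval z := by
  let _ : Invertible z := invertibleOfNonzero hz
  have := eval₂_reflect_mul_pow (RingHom.id ℂ) z n P hP
  simpa [invOf_eq_inv] using this

lemma eval_zero_reflect (n : ℕ) (P : ℂ[X]) : (reflect n P).eval 0 = P.coeff n := by
  rw [← coeff_zero_eq_eval_zero, coeff_reflect, revAt_le (Nat.zero_le _), Nat.sub_zero]

/-- Reflection carries `|z| ≥ k`, infinity included, to the disc of radius `1/k`, where the maximum
principle applies to the quotient. Zeros of `G` strictly inside `|z| < k` keep the denominator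
nonzero on the closed disc; at `0` it equals the leading coefficient of `G`. -/
lemma norm_reflect_le {n : ℕ} {k M : ℝ} (hk : 0 < k) {P G : ℂ[X]} (hP : P.natDegree ≤ n)
    (hG : G.natDegree = n) (hG0 : G ≠ 0) (hz : ∀ z, G.eval z = 0 → ‖z‖ < k)
    (hM : ∀ z : ℂ, ‖z‖ = k → ‖P.eval z‖ ≤ M * ‖G.eval z‖) {w : ℂ} (hw : ‖w‖ ≤ k⁻¹) :
    ‖(reflect n P).eval w‖ ≤ M * ‖(reflect n G).eval w‖ := by
  have hk' : k⁻¹ ≠ 0 := (inv_pos.mpr hk).ne'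
  have hne : ∀ w ∈ Metric.closedBall (0 : ℂ) k⁻¹, (reflect n G).eval w ≠ 0 := by
    intro w hw h
    rw [mem_closedBall_zero_iff] at hw
    by_cases h0 : w = 0
    · subst h0
      rw [eval_zero_reflect, ← hG] at h
      exact hG0 (leadingCoeff_eq_zero.mp h)
    · have e := eval_reflect_inv hG.le (inv_ne_zero h0)
      rw [inv_inv, h, zero_mul] at e
      have := hz _ e.symm
      rw [norm_inv] at this
      exact absurd ((le_inv_comm₀ (norm_pos_iff.mpr h0) hk).mp hw) (not_le.mpr this)
  have hdiff : DiffContOnCl ℂ (fun w => (reflect n P).eval w / (reflect n G).eval w)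
      (Metric.ball 0 k⁻¹) := by
    refine DifferentiableOn.diffContOnCl ?_
    rw [closure_ball _ hk']
    exact (Polynomial.differentiable _).differentiableOn.div
      (Polynomial.differentiable _).differentiableOn hne
  have := Complex.norm_le_of_forall_mem_frontier_norm_le (C := M) Metric.isBounded_ball hdiff
    (fun w hw => by
      rw [frontier_ball _ hk', mem_sphere_zero_iff_norm] at hw
      have h0 : w ≠ 0 := norm_ne_zero_iff.mp (hw ▸ hk')
      have hG' := hne w (by rw [mem_closedBall_zero_iff, hw])
      rw [norm_div, div_le_iff₀ (norm_pos_iff.mpr hG')]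
      have h := hM w⁻¹ (by rw [norm_inv, hw, inv_inv])
      rw [← eval_reflect_inv hP (inv_ne_zero h0), ← eval_reflect_inv hG.le (inv_ne_zero h0),
        inv_inv, norm_mul, norm_mul, ← mul_assoc] at h
      exact le_of_mul_le_mul_right h (norm_pos_iff.mpr (pow_ne_zero _ (inv_ne_zero h0))))
    (z := w) (by rw [closure_ball _ hk', mem_closedBall_zero_iff]; exact hw)
  rwa [norm_div, div_le_iff₀ (norm_pos_iff.mpr
    (hne w (by rw [mem_closedBall_zero_iff]; exact hw)))] at this

open Filter Topology

lemma eval_dilate (P : ℂ[X]) (s : ℝ) (z : ℂ) : (dilate P s).eval z = P.eval (s * z) := by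
  simp [dilate]

lemma coeff_dilate (P : ℂ[X]) (s : ℝ) (j : ℕ) :
    (dilate P s).coeff j = P.coeff j * (s : ℂ) ^ j := by
  rw [dilate, comp_C_mul_X_coeff]

lemma natDegree_dilate_le {n : ℕ} {P : ℂ[X]} (hP : P.natDegree ≤ n) (s : ℝ) :
    (dilate P s).natDegree ≤ n :=
  natDegree_le_iff_coeff_eq_zero.mpr fun j hj => by
    rw [coeff_dilate, coeff_eq_zero_of_natDegree_lt (hP.trans_lt hj), zero_mul]

lemma dilate_add_C_mul (P Q : ℂ[X]) (a : ℂ) (s : ℝ) :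
    dilate (P + C a * Q) s = dilate P s + C a * dilate Q s := by
  simp [dilate]

lemma coeff_ne_zero_of_natDegree_eq {n : ℕ} {F : ℂ[X]} (hF : F.natDegree = n) (hF0 : F ≠ 0) :
    F.coeff n ≠ 0 := by
  rw [← hF]; exact leadingCoeff_ne_zero.mpr hF0

lemma natDegree_eq_and_ne_zero_of_coeff_ne_zero {n : ℕ} {P : ℂ[X]} (hP : P.natDegree ≤ n)
    (h : P.coeff n ≠ 0) : P.natDegree = n ∧ P ≠ 0 :=
  ⟨natDegree_eq_of_le_of_coeff_ne_zero hP h, fun e => h (by simp [e])⟩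

/-- Zeros of `F` on the circle itself are avoided by dilating `F`, which pulls its zeros strictly
inside. The growth estimate with radii `k` and `sk` gives the factor `(2k / (sk + k))ⁿ`, which tends
to `1` as `s → 1`. -/
lemma norm_reflect_le_of_one_lt {n : ℕ} {k s : ℝ} (hk : 0 < k) (hs : 1 < s) {P F : ℂ[X]}
    (hP : P.natDegree ≤ n) (hF : F.natDegree = n) (hF0 : F ≠ 0)
    (hz : ∀ z, F.eval z = 0 → ‖z‖ ≤ k)
    (hPF : ∀ z : ℂ, ‖z‖ = k → ‖P.eval z‖ ≤ ‖F.eval z‖) {w : ℂ} (hw : ‖w‖ ≤ k⁻¹) :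
    ‖(reflect n P).eval w‖ ≤ (2 / (s + 1)) ^ n * ‖(reflect n (dilate F s)).eval w‖ := by
  have hs0 : 0 < s := one_pos.trans hs
  obtain ⟨hd, hd0⟩ := natDegree_eq_and_ne_zero_of_coeff_ne_zero (natDegree_dilate_le hF.le s) (by
    rw [coeff_dilate]
    exact mul_ne_zero (coeff_ne_zero_of_natDegree_eq hF hF0)
      (pow_ne_zero _ (Complex.ofReal_ne_zero.mpr hs0.ne')))
  refine norm_reflect_le hk hP hd hd0 (fun z h => ?_) (fun z h => ?_) hw
  · have := hz _ (by rwa [eval_dilate] at h)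
    rw [norm_mul, Complex.norm_real, Real.norm_of_nonneg hs0.le] at this
    nlinarith [norm_nonneg z]
  · refine (hPF z h).trans ?_
    have hkC : (k : ℂ) ≠ 0 := Complex.ofReal_ne_zero.mpr hk.ne'
    have := add_pow_mul_norm_eval_le hk le_rfl (le_mul_of_one_le_left hk.le hs.le) hF hF0 hz
      (u := z / k) (by rw [norm_div, Complex.norm_real, Real.norm_of_nonneg hk.le, h, div_self hk.ne'])
    rw [Complex.ofReal_mul, mul_assoc, mul_div_cancel₀ _ hkC,
      show s * k + k = k * (s + 1) by ring, show k + k = k * 2 by ring, mul_pow, mul_pow,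
      mul_assoc, mul_assoc] at this
    have := le_of_mul_le_mul_left this (pow_pos hk n)
    rw [eval_dilate, div_pow, div_mul_eq_mul_div, le_div_iff₀ (by positivity)]
    linarith

lemma le_of_forall_one_lt_le_pow_mul {n : ℕ} {x : ℝ} {f : ℝ → ℝ} (hf : Continuous f)
    (h : ∀ s : ℝ, 1 < s → x ≤ (2 / (s + 1)) ^ n * f s) : x ≤ f 1 := by
  have ht : Tendsto (fun s : ℝ => (2 / (s + 1)) ^ n * f s) (𝓝[>] 1) (𝓝 (f 1)) := by
    have hc : ContinuousAt (fun s : ℝ => (2 / (s + 1)) ^ n * f s) 1 :=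
      ((continuousAt_const.div (by fun_prop) (by norm_num)).pow n).mul hf.continuousAt
    have := hc.tendsto.mono_left (nhdsWithin_le_nhds (s := Set.Ioi 1))
    norm_num at this
    exact this
  exact ge_of_tendsto ht (eventually_mem_nhdsWithin.mono fun s hs => h s hs)

section Domination

variable {n : ℕ} {k : ℝ} {P F : ℂ[X]}

/-- Domination at infinity, the point `w = 0` after reflection. It keeps the degree of `P + aF` from
dropping. -/
lemma norm_coeff_le_of_circle (hk : 0 < k) (hP : P.natDegree ≤ n) (hF : F.natDegree = n)
    (hF0 : F ≠ 0) (hz : ∀ z, F.eval z = 0 → ‖z‖ ≤ k)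
    (hPF : ∀ z : ℂ, ‖z‖ = k → ‖P.eval z‖ ≤ ‖F.eval z‖) : ‖P.coeff n‖ ≤ ‖F.coeff n‖ := by
  have := le_of_forall_one_lt_le_pow_mul (n := n) (x := ‖P.coeff n‖)
    (f := fun s => ‖F.coeff n * (s : ℂ) ^ n‖) (by fun_prop) fun s hs => by
      have := norm_reflect_le_of_one_lt hk hs hP hF hF0 hz hPF (w := 0)
        (by simpa using hk.le)
      rwa [eval_zero_reflect, eval_zero_reflect, coeff_dilate] at this
  simpa using this

lemma norm_eval_le_of_circle (hk : 0 < k) (hP : P.natDegree ≤ n) (hF : F.natDegree = n)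
    (hF0 : F ≠ 0) (hz : ∀ z, F.eval z = 0 → ‖z‖ ≤ k)
    (hPF : ∀ z : ℂ, ‖z‖ = k → ‖P.eval z‖ ≤ ‖F.eval z‖) {z : ℂ} (hkz : k ≤ ‖z‖) :
    ‖P.eval z‖ ≤ ‖F.eval z‖ := by
  have hz0 : z ≠ 0 := norm_pos_iff.mp (hk.trans_le hkz)
  have := le_of_forall_one_lt_le_pow_mul (n := n) (x := ‖P.eval z‖)
    (f := fun s => ‖F.eval ((s : ℂ) * z)‖) (by fun_prop) fun s hs => by
      have := norm_reflect_le_of_one_lt hk hs hP hF hF0 hz hPF (w := z⁻¹)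
        (by rw [norm_inv]; exact inv_anti₀ hk hkz)
      have := mul_le_mul_of_nonneg_right this (norm_nonneg (z ^ n))
      rwa [mul_assoc, ← norm_mul, ← norm_mul, eval_reflect_inv hP hz0,
        eval_reflect_inv (natDegree_dilate_le hF.le s) hz0, eval_dilate] at this
  simpa using this

lemma add_C_mul_zeros_of_circle (hk : 0 < k) (hP : P.natDegree ≤ n) (hF : F.natDegree = n)
    (hF0 : F ≠ 0) (hz : ∀ z, F.eval z = 0 → ‖z‖ ≤ k)
    (hPF : ∀ z : ℂ, ‖z‖ = k → ‖P.eval z‖ ≤ ‖F.eval z‖) {a : ℂ} (ha : 1 < ‖a‖) :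
    (P + C a * F).natDegree = n ∧ P + C a * F ≠ 0 ∧
      ∀ z, (P + C a * F).eval z = 0 → ‖z‖ ≤ k := by
  have aux : ∀ p f : ℂ, f ≠ 0 → ‖p‖ ≤ ‖f‖ → p + a * f ≠ 0 := fun p f hf hpf h => by
    rw [eq_neg_of_add_eq_zero_left h, norm_neg, norm_mul] at hpf
    have := norm_pos_iff.mpr hf
    nlinarith
  have hcoeff : (P + C a * F).coeff n ≠ 0 := by
    rw [coeff_add, coeff_C_mul]
    exact aux _ _ (coeff_ne_zero_of_natDegree_eq hF hF0)
      (norm_coeff_le_of_circle hk hP hF hF0 hz hPF)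
  obtain ⟨h1, h2⟩ := natDegree_eq_and_ne_zero_of_coeff_ne_zero
    (natDegree_add_le_of_degree_le hP ((natDegree_C_mul_le a F).trans hF.le)) hcoeff
  refine ⟨h1, h2, fun z h => ?_⟩
  by_contra! hlt
  rw [eval_add, eval_C_mul] at h
  exact aux _ _ (fun e => absurd (hz z e) (not_le.mpr hlt))
    (norm_eval_le_of_circle hk hP hF hF0 hz hPF hlt.le) h

end Domination

/-! ### Zeros of the dilated combination, and the comparison. -/

/-- `P(R z) + β ((R+k)/(k+r))ⁿ P(r z)` as a polynomial in `z`. -/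
noncomputable def dilateCombo (n : ℕ) (k R r : ℝ) (β : ℂ) (P : ℂ[X]) : ℂ[X] :=
  dilate P R + C (β * ((((R + k) / (k + r)) ^ n : ℝ) : ℂ)) * dilate P r

lemma dilateCombo_add_C_mul (n : ℕ) (k R r : ℝ) (β a : ℂ) (P Q : ℂ[X]) :
    dilateCombo n k R r β (P + C a * Q)
      = dilateCombo n k R r β P + C a * dilateCombo n k R r β Q := by
  simp only [dilateCombo, dilate_add_C_mul]
  ring

lemma dilateCombo_zeros {n : ℕ} (hn : 1 ≤ n) {k R r : ℝ} (hk : 0 < k) (hkr : k ≤ r) (hrR : r < R)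
    {β : ℂ} (hβ : ‖β‖ ≤ 1) {G : ℂ[X]} (hG : G.natDegree = n) (hG0 : G ≠ 0)
    (hz : ∀ z, G.eval z = 0 → ‖z‖ ≤ k) :
    (dilateCombo n k R r β G).natDegree = n ∧ dilateCombo n k R r β G ≠ 0 ∧
      ∀ z, (dilateCombo n k R r β G).eval z = 0 → ‖z‖ ≤ 1 := by
  have hr : 0 < r := hk.trans_le hkr
  have hR : 0 < R := hr.trans hrR
  have hn0 : n ≠ 0 := by omega
  have hq : 0 < (R + k) / (k + r) := by positivity
  have hnorm : ‖β * ((((R + k) / (k + r)) ^ n : ℝ) : ℂ)‖ ≤ ((R + k) / (k + r)) ^ n := by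
    rw [norm_mul, Complex.norm_real, Real.norm_of_nonneg (by positivity)]
    exact mul_le_of_le_one_left (by positivity) hβ
  set q := β * ((((R + k) / (k + r)) ^ n : ℝ) : ℂ) with hqdef
  have hcoeff : (dilateCombo n k R r β G).coeff n ≠ 0 := by
    rw [dilateCombo, coeff_add, coeff_C_mul, coeff_dilate, coeff_dilate, ← hqdef, mul_left_comm,
      ← mul_add]
    refine mul_ne_zero (coeff_ne_zero_of_natDegree_eq hG hG0) fun h => ?_
    -- Taking `n`-th roots would give `R(k + r) ≤ (R + k)r`, that is `R ≤ r`.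
    have h1 : R ^ n ≤ ((R + k) / (k + r)) ^ n * r ^ n := by
      have := congrArg norm (eq_neg_of_add_eq_zero_left h)
      rw [norm_neg, norm_mul, norm_pow, norm_pow, Complex.norm_real, Complex.norm_real,
        Real.norm_of_nonneg hR.le, Real.norm_of_nonneg hr.le] at this
      rw [this]
      gcongr
    rw [← mul_pow, pow_le_pow_iff_left₀ hR.le (by positivity) hn0, div_mul_eq_mul_div,
      le_div_iff₀ (by positivity)] at h1
    nlinarith
  obtain ⟨h1, h2⟩ := natDegree_eq_and_ne_zero_of_coeff_ne_zero (natDegree_add_le_of_degree_le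
    (natDegree_dilate_le hG.le R)
    ((natDegree_C_mul_le _ _).trans (natDegree_dilate_le hG.le r))) hcoeff
  refine ⟨h1, h2, fun z h => ?_⟩
  by_contra! ht
  have ht0 : 0 < ‖z‖ := one_pos.trans ht
  have htC : (‖z‖ : ℂ) ≠ 0 := Complex.ofReal_ne_zero.mpr ht0.ne'
  -- Growth between the radii `r|z|` and `R|z|`. A zero with `|z| > 1` would force `(R|z| + k)(k +
  -- r) ≤ (r|z| + k)(R + k)`, whereas left minus right is `k(|z| - 1)(R - r) > 0`.
  have hratio := add_pow_mul_norm_eval_le hk (hkr.trans (le_mul_of_one_le_right hr.le ht.le))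
    (mul_le_mul_of_nonneg_right hrR.le ht0.le) hG hG0 hz (u := z / ‖z‖) (by
      rw [norm_div, Complex.norm_real, norm_norm, div_self ht0.ne'])
  rw [Complex.ofReal_mul, Complex.ofReal_mul, mul_assoc, mul_assoc, mul_div_cancel₀ _ htC] at hratio
  have hpos : 0 < ‖G.eval (r * z)‖ := norm_pos_iff.mpr fun e => by
    have := hz _ e
    rw [norm_mul, Complex.norm_real, Real.norm_of_nonneg hr.le] at this
    nlinarith
  rw [dilateCombo, eval_add, eval_C_mul, eval_dilate, eval_dilate, ← hqdef] at h
  have hle : ‖G.eval (R * z)‖ ≤ ((R + k) / (k + r)) ^ n * ‖G.eval (r * z)‖ := by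
    rw [eq_neg_of_add_eq_zero_left h, norm_neg, norm_mul]
    gcongr
  have h3 := hratio.trans (mul_le_mul_of_nonneg_left hle (by positivity))
  rw [← mul_assoc, ← mul_pow] at h3
  have h4 := le_of_mul_le_mul_right h3 hpos
  rw [pow_le_pow_iff_left₀ (by positivity) (by positivity) hn0, mul_div_assoc',
    le_div_iff₀ (by positivity)] at h4
  nlinarith [mul_pos (mul_pos hk (sub_pos.mpr ht)) (sub_pos.mpr hrR)]

lemma operatorValue_add_C_mul (n : ℕ) (l0 l1 l2 a : ℂ) (P Q : ℂ[X]) (z : ℂ) :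
    operatorValue n l0 l1 l2 (P + C a * Q) z
      = operatorValue n l0 l1 l2 P z + a * operatorValue n l0 l1 l2 Q z := by
  simp only [operatorValue, derivative_add, derivative_C_mul, eval_add, eval_C_mul]
  ring

lemma continuous_operatorValue (n : ℕ) (l0 l1 l2 : ℂ) (P : ℂ[X]) :
    Continuous (operatorValue n l0 l1 l2 P) := by
  unfold operatorValue
  fun_prop

lemma combo_eq_operatorValue {n : ℕ} {B : ℂ[X] → ℂ[X]} {l0 l1 l2 : ℂ}
    (hB : ∀ P : ℂ[X], P.natDegree ≤ n → ∀ z : ℂ, (B P).eval z = operatorValue n l0 l1 l2 P z)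
    (k R r : ℝ) (β : ℂ) {P : ℂ[X]} (hP : P.natDegree ≤ n) (z : ℂ) :
    combo n B k R r β P z = operatorValue n l0 l1 l2 (dilateCombo n k R r β P) z := by
  rw [combo, hB _ (natDegree_dilate_le hP R), hB _ (natDegree_dilate_le hP r), dilateCombo,
    operatorValue_add_C_mul]

lemma norm_le_norm_of_forall_one_lt {f g : ℂ → ℂ} (hf : Continuous f) (hg : Continuous g)
    (h : ∀ z : ℂ, 1 < ‖z‖ → ‖f z‖ ≤ ‖g z‖) {z : ℂ} (hz : 1 ≤ ‖z‖) : ‖f z‖ ≤ ‖g z‖ := by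
  have ht : ∀ f : ℂ → ℂ, Continuous f →
      Tendsto (fun t : ℝ => ‖f (t * z)‖) (𝓝[>] 1) (𝓝 ‖f z‖) := fun f hf => by
    have hc : Continuous fun t : ℝ => ‖f (t * z)‖ := by fun_prop
    have := (hc.tendsto 1).mono_left (nhdsWithin_le_nhds (s := Set.Ioi 1))
    simpa using this
  refine le_of_tendsto_of_tendsto (ht f hf) (ht g hg) (eventually_mem_nhdsWithin.mono fun t htt => ?_)
  have htt : 1 < t := htt
  refine h _ ?_
  rw [norm_mul, Complex.norm_real, Real.norm_of_nonneg (by linarith)]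
  nlinarith

lemma norm_operatorValue_dilateCombo_le {n : ℕ} {l0 l1 l2 : ℂ}
    (hU : ∀ z : ℂ, charU n l0 l1 l2 z = 0 → ‖z‖ ≤ ‖z - (n : ℂ) / 2‖)
    {k R r : ℝ} (hk : 0 < k) (hkr : k ≤ r) (hrR : r < R) {P F : ℂ[X]}
    (hF : F.natDegree = n) (hF0 : F ≠ 0) (hz : ∀ z, F.eval z = 0 → ‖z‖ ≤ k)
    (hP : P.natDegree ≤ n) (hPF : ∀ z : ℂ, ‖z‖ = k → ‖P.eval z‖ ≤ ‖F.eval z‖)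
    {β : ℂ} (hβ : ‖β‖ ≤ 1) {z : ℂ} (h1 : 1 ≤ ‖z‖) :
    ‖operatorValue n l0 l1 l2 (dilateCombo n k R r β P) z‖
      ≤ ‖operatorValue n l0 l1 l2 (dilateCombo n k R r β F) z‖ := by
  -- Constants are treated directly: for `n = 0` the combination is multiplication by `1 + β`, which
  -- vanishes at `β = -1`.
  rcases Nat.eq_zero_or_pos n with h0 | hn
  · subst h0
    rw [eq_C_of_natDegree_le_zero hP, eq_C_of_natDegree_le_zero hF.le] at hPF ⊢
    have := hPF k (by simpa using hk.le)
    simp only [eval_C] at this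
    have hC : ∀ a : ℂ, operatorValue 0 l0 l1 l2 (dilateCombo 0 k R r β (C a)) z
        = l0 * (1 + β) * a := fun a => by
      simp [operatorValue, dilateCombo, dilate]
      ring
    rw [hC, hC, norm_mul, norm_mul _ (F.coeff 0)]
    gcongr
  refine norm_le_norm_of_forall_one_lt (continuous_operatorValue ..) (continuous_operatorValue ..)
    (fun z h1 => ?_) h1
  obtain ⟨g1, g2, g3⟩ := dilateCombo_zeros hn hk hkr hrR hβ hF hF0 hz
  have hne := operatorValue_ne_zero hn hU g1 g2 g3 h1
  by_contra! hlt
  set p := operatorValue n l0 l1 l2 (dilateCombo n k R r β P) z with hp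
  set f := operatorValue n l0 l1 l2 (dilateCombo n k R r β F) z with hf
  have ha : 1 < ‖-(p / f)‖ := by
    rw [norm_neg, norm_div, one_lt_div (norm_pos_iff.mpr hne)]; exact hlt
  obtain ⟨d1, d2, d3⟩ := add_C_mul_zeros_of_circle hk hP hF hF0 hz hPF ha
  obtain ⟨e1, e2, e3⟩ := dilateCombo_zeros hn hk hkr hrR hβ d1 d2 d3
  refine operatorValue_ne_zero hn hU e1 e2 e3 h1 ?_
  rw [dilateCombo_add_C_mul, operatorValue_add_C_mul, ← hp, ← hf]
  field_simp
  ring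

end BnOperator

theorem corollary2p2 (n : ℕ) (B : Polynomial ℂ → Polynomial ℂ) (hB : BnOperator.MemClass n B)
    (k R r : ℝ) (hk : 0 < k) (hkr : k ≤ r) (hrR : r < R)
    (F : Polynomial ℂ) (hFdeg : F.degree = (n : WithBot ℕ))
    (hFzeros : ∀ z : ℂ, F.eval z = 0 → ‖z‖ ≤ k) :
    (∀ P : Polynomial ℂ, BnOperator.Admissible n k F P →
      ∀ β : ℂ, ‖β‖ ≤ 1 → ∀ z : ℂ, 1 ≤ ‖z‖ →
        ‖BnOperator.combo n B k R r β P z‖ ≤ ‖BnOperator.combo n B k R r β F z‖) ∧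
    (∀ γ : ℝ,
      BnOperator.Admissible n k F (Polynomial.C (Complex.exp (Complex.I * (γ : ℂ))) * F) ∧
      ∀ β : ℂ, ‖β‖ ≤ 1 → ∀ z : ℂ, 1 ≤ ‖z‖ →
        ‖BnOperator.combo n B k R r β (Polynomial.C (Complex.exp (Complex.I * (γ : ℂ))) * F) z‖
          = ‖BnOperator.combo n B k R r β F z‖) := by
  obtain ⟨l0, l1, l2, hU, hB⟩ := hB
  have hF : F.natDegree = n := natDegree_eq_of_degree_eq_some hFdeg
  have hF0 : F ≠ 0 := fun h => by simp [h] at hFdeg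
  refine ⟨fun P hP β hβ z hz => ?_, fun γ => ?_⟩
  · rw [BnOperator.combo_eq_operatorValue hB k R r β hP.1,
      BnOperator.combo_eq_operatorValue hB k R r β hF.le]
    exact BnOperator.norm_operatorValue_dilateCombo_le hU hk hkr hrR hF hF0 hFzeros hP.1 hP.2 hβ hz
  · have hexp : ‖Complex.exp (Complex.I * (γ : ℂ))‖ = 1 := by
      rw [mul_comm, Complex.norm_exp_ofReal_mul_I]
    have hdeg : (C (Complex.exp (Complex.I * (γ : ℂ))) * F).natDegree ≤ n :=
      (natDegree_C_mul_le _ _).trans hF.le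
    refine ⟨⟨hdeg, fun z _ => by rw [eval_C_mul, norm_mul, hexp, one_mul]⟩, fun β _ z _ => ?_⟩
    -- Writing the polynomial as `0 + C a * F` lets the additivity lemmas pull out the unimodular
    -- constant.
    rw [BnOperator.combo_eq_operatorValue hB k R r β hdeg,
      BnOperator.combo_eq_operatorValue hB k R r β hF.le, ← zero_add (C _ * F),
      BnOperator.dilateCombo_add_C_mul, BnOperator.operatorValue_add_C_mul]
    simp [BnOperator.operatorValue, BnOperator.dilateCombo, BnOperator.dilate, hexp]
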